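/- Let $G$ be an amenable, unimodular, locally compact second-countable (Hausdorff) group with identity $e$ and Haar measure $m$. Let $(F_n)_{n\in\mathbb N}$ be a (right) strong Følner sequence in $G$ (such a sequence exists exactly when $G$ is amenable), i.e. a sequence of compact sets of positive measure with $$\lim_{n\to\infty}\frac{m(F_nK\cap F_n^cK)}{m(F_n)}=0\qquad\text{for every compact }K\subseteq G .$$ Let $\mathcal H$ be a reproducing kernel Hilbert space of complex-valued functions on $G$, i.e. a Hilbert space of functions on which all point evaluations are continuous, and let $k_x\in\mathcal H$ be the vector with $f(x)=\langle f,k_x\rangle$ for all $f\in\mathcal H$. Suppose that (a) $\mathcal H$ is isometrically embedded into $L^2(G)$; (b) for all $f\in\mathcal H$ and $x\in G$ the translate $y\mapsto f(x^{-1}y)$ is in $\mathcal H$; (c) for some compact neighborhood $Q$ of $e$ one has $\int_G\sup_{t\in xQ}|f(t)|^2\,dx<\infty$ for all $f\in\mathcal H$. For $\Lambda\subseteq G$ let $$D^-(\Lambda)=\sup_K\inf_{x\in G}\frac{|\Lambda\cap xK|}{m(K)},\qquad D^+(\Lambda)=\inf_K\sup_{x\in G}\frac{|\Lambda\cap xK|}{m(K)},$$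 where $K$ runs over the compact subsets of $G$ of positive measure, and let the densities along $(F_n)$ be $$D^-_F(\Lambda)=\liminf_{n\to\infty}\inf_{x\in G}\frac{|\Lambda\cap xF_n|}{m(F_n)},\qquad D^+_F(\Lambda)=\limsup_{n\to\infty}\sup_{x\in G}\frac{|\Lambda\cap xF_n|}{m(F_n)} .$$ Then for every subset $\Lambda\subseteq G$: (i) If $\Lambda$ is a set of sampling for $\mathcal H$, that is, there are $A,B>0$ with $A\|f\|^2\le\sum_{\lambda\in\Lambda}|f(\lambda)|^2\le B\|f\|^2$ for all $f\in\mathcal H$, then $D^-_F(\Lambda)\ge\|k_e\|^2$ and $D^-(\Lambda)\ge\|k_e\|^2$. (ii) If $\Lambda$ is a set of interpolation for $\mathcal H$, that is, for every $(c_\lambda)_{\lambda\in\Lambda}\in\ell^2(\Lambda)$ there is $f\in\mathcal H$ with $f(\lambda)=c_\lambda$ for all $\lambda\in\Lambda$, then $D^+_F(\Lambda)\le\|k_e\|^2$ and $D^+(\Lambda)\le\|k_e\|^2$. -/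

import Mathlib

open MeasureTheory Filter Topology Set
open scoped ENNReal Pointwise

noncomputable section

namespace SamplingDensity

section Density

variable {G : Type*} [Group G] [TopologicalSpace G] [MeasurableSpace G]

/-- A (right) strong Følner sequence: compact sets `F n` of positive measure such that
`m(F_n K ∩ F_nᶜ K) / m(F_n) → 0` for every compact `K`. Positivity of the measures is what makes
the quotients meaningful. -/
structure IsStrongFolner (μ : Measure G) (F : ℕ → Set G) : Prop where
  isCompact : ∀ n, IsCompact (F n)
  measure_pos : ∀ n, 0 < μ (F n)
  tendsto : ∀ K : Set G, IsCompact K →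
    Tendsto (fun n => μ ((F n * K) ∩ ((F n)ᶜ * K)) / μ (F n)) atTop (𝓝 0)

/-- The number `|Λ ∩ xK| / m(K)` in `[0, ∞]`. -/
def countRatio (μ : Measure G) (Λ K : Set G) (x : G) : ℝ≥0∞ :=
  ((Λ ∩ x • K).encard : ℝ≥0∞) / μ K

/-- Lower Beurling density: `sup_K inf_x |Λ ∩ xK| / m(K)`, with `K` ranging over the compact sets
of positive measure. -/
def lowerBeurlingDensity (μ : Measure G) (Λ : Set G) : ℝ≥0∞ :=
  ⨆ (K : Set G) (_ : IsCompact K) (_ : 0 < μ K), ⨅ x : G, countRatio μ Λ K x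

/-- Upper Beurling density: `inf_K sup_x |Λ ∩ xK| / m(K)`, with `K` ranging over the compact sets
of positive measure. -/
def upperBeurlingDensity (μ : Measure G) (Λ : Set G) : ℝ≥0∞ :=
  ⨅ (K : Set G) (_ : IsCompact K) (_ : 0 < μ K), ⨆ x : G, countRatio μ Λ K x

/-- Lower Beurling density along a sequence: the lower limit of `inf_x |Λ ∩ xF_n| / m(F_n)`
(which is the limit whenever the limit exists). -/
def lowerBeurlingDensityAlong (μ : Measure G) (F : ℕ → Set G) (Λ : Set G) : ℝ≥0∞ :=
  liminf (fun n => ⨅ x : G, countRatio μ Λ (F n) x) atTop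

/-- Upper Beurling density along a sequence: the upper limit of `sup_x |Λ ∩ xF_n| / m(F_n)`
(which is the limit whenever the limit exists). -/
def upperBeurlingDensityAlong (μ : Measure G) (F : ℕ → Set G) (Λ : Set G) : ℝ≥0∞ :=
  limsup (fun n => ⨆ x : G, countRatio μ Λ (F n) x) atTop

end Density

section RKHS

variable {G : Type*} (H : Type*) [NormedAddCommGroup H] [InnerProductSpace ℂ H]
  [RKHS ℂ H G ℂ]

/-- The reproducing kernel vector `k_x ∈ H`. -/
def kernelVector [CompleteSpace H] (x : G) : H := RKHS.kerFun H x (1 : ℂ)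

/-- The reproducing property `f(x) = ⟨f, k_x⟩` (the inner product of Mathlib is linear in its
second argument). -/
theorem inner_kernelVector [CompleteSpace H] (x : G) (f : H) :
    inner ℂ (kernelVector H x) f = f x := by
  simp [kernelVector]

/-- `H` is isometrically embedded into `L²(G, μ)`: every element of `H` is a square integrable
function, and its norm in `H` is its `L²`-norm. -/
def IsIsometricallyEmbedded [MeasurableSpace G] (μ : Measure G) : Prop :=
  ∀ f : H, MemLp (f : G → ℂ) 2 μ ∧ ‖f‖ₑ = eLpNorm (f : G → ℂ) 2 μ

/-- `H` is invariant under the left translations `f ↦ f(x⁻¹ ·)`. -/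
def IsTranslationInvariant [Group G] : Prop :=
  ∀ (f : H) (x : G), ∃ g : H, ∀ y : G, g y = f (x⁻¹ * y)

/-- Localization: for some compact neighbourhood `Q` of the identity,
`∫ sup_{t ∈ xQ} |f(t)|² dx < ∞` for all `f ∈ H`. -/
def IsLocalized [Group G] [TopologicalSpace G] [MeasurableSpace G] (μ : Measure G) : Prop :=
  ∃ Q : Set G, IsCompact Q ∧ Q ∈ 𝓝 (1 : G) ∧
    ∀ f : H, ∫⁻ x, (⨆ t ∈ x • Q, ‖f t‖ₑ ^ 2) ∂μ < ∞

/-- `Λ` is a set of sampling for `H`: for some `A, B > 0`,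
`A ‖f‖² ≤ ∑_{λ ∈ Λ} |f(λ)|² ≤ B ‖f‖²` for all `f ∈ H`. -/
def IsSamplingSet (Λ : Set G) : Prop :=
  ∃ A B : ℝ, 0 < A ∧ 0 < B ∧ ∀ f : H,
    ENNReal.ofReal A * ‖f‖ₑ ^ 2 ≤ ∑' l : Λ, ‖f (l : G)‖ₑ ^ 2 ∧
    ∑' l : Λ, ‖f (l : G)‖ₑ ^ 2 ≤ ENNReal.ofReal B * ‖f‖ₑ ^ 2

/-- `Λ` is a set of interpolation for `H`: every `c ∈ ℓ²(Λ)` is the restriction to `Λ` of some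
`f ∈ H`. -/
def IsInterpolationSet (Λ : Set G) : Prop :=
  ∀ c : lp (fun _ : Λ => ℂ) 2, ∃ f : H, ∀ l : Λ, f (l : G) = c l

end RKHS

end SamplingDensity

end

/-! For a finite-dimensional subspace V of H with projection P, the trace formula
`lintegral_enorm_starProjection_kernelVector` says that the integral of ‖P k_y‖² over G equals dim
V. Since ‖k_y‖ = ‖k_e‖ by translation invariance, each density bound follows by choosing V so that
‖P k_y‖² is nearly ‖k_e‖², or nearly zero, where needed.

Sampling (`exists_isCompact_mul_measure_le_encard`): the restriction map to ℓ²(Λ) has a bounded left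
inverse R. Let V be spanned by the images under R of the unit vectors at points of Λ ∩ xFK.
Localization makes k_y|Λ uniformly concentrated near y, so k_y is close to V for all y in xF, and
‖k_e‖² m(F) is at most dim V plus a small multiple of m(F).

Interpolation (`exists_isCompact_encard_le_mul_measure`): let V be spanned by the k_λ with λ in Λ ∩
xF', where F' consists of the t in F with tK ⊆ F. These vectors are independent, so dim V is the
number of points. On xF one has ‖P k_y‖ ≤ ‖k_e‖; off xF the integral is small because k_e is square
integrable.

Both estimates count points in a perturbation of F. Since Λ has bounded overlap, the strong Følner
condition makes the difference negligible. -/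

set_option linter.unusedSectionVars false

noncomputable section

namespace SamplingDensity

/-! ### Kernel vectors, translations and the trace formula -/

section Kernel

variable {G : Type*} {H : Type*} [NormedAddCommGroup H] [InnerProductSpace ℂ H]
  [CompleteSpace H] [RKHS ℂ H G ℂ]

lemma kernelVector_apply_eq_inner (x y : G) :
    kernelVector H x y = inner ℂ (kernelVector H y) (kernelVector H x) :=
  (inner_kernelVector H y _).symm

lemma enorm_kernelVector_apply_comm (x y : G) :
    ‖kernelVector H x y‖ₑ = ‖kernelVector H y x‖ₑ := by
  rw [kernelVector_apply_eq_inner, kernelVector_apply_eq_inner, ← ofReal_norm, ← ofReal_norm,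
    norm_inner_symm]

variable [Group G] [TopologicalSpace G] [IsTopologicalGroup G] [MeasurableSpace G] [BorelSpace G]
  {μ : Measure G} [μ.IsHaarMeasure]

/-- Left translation as a linear isometry of a translation invariant space. -/
def translation (hL2 : IsIsometricallyEmbedded H μ) (hinv : IsTranslationInvariant (G := G) H)
    (x : G) : H →ₗᵢ[ℂ] H where
  toFun f := (hinv f x).choose
  map_add' f g := by
    refine RKHS.ext fun y => ?_
    rw [(hinv _ x).choose_spec y]
    simp [(hinv f x).choose_spec y, (hinv g x).choose_spec y]
  map_smul' c f := by
    refine RKHS.ext fun y => ?_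
    rw [(hinv _ x).choose_spec y]
    simp [(hinv f x).choose_spec y]
  norm_map' f := by
    have h : ‖(hinv f x).choose‖ₑ = ‖f‖ₑ := by
      rw [(hL2 f).2, (hL2 _).2]
      have : (((hinv f x).choose : H) : G → ℂ) = (f : G → ℂ) ∘ (fun y => x⁻¹ * y) :=
        funext (hinv f x).choose_spec
      rw [this]
      exact eLpNorm_comp_measurePreserving (hL2 f).1.1 (measurePreserving_mul_left μ x⁻¹)
    simpa [enorm_eq_nnnorm, ← NNReal.coe_inj] using h

lemma translation_apply (hL2 : IsIsometricallyEmbedded H μ)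
    (hinv : IsTranslationInvariant (G := G) H) (x : G) (f : H) (y : G) :
    translation hL2 hinv x f y = f (x⁻¹ * y) :=
  (hinv f x).choose_spec y

/-- Translation by x is an isometry inverted by translation by x⁻¹, so pairing the translate of k_1
with f gives (x⁻¹-translate of f)(1) = f(x). -/
lemma translation_kernelVector_one (hL2 : IsIsometricallyEmbedded H μ)
    (hinv : IsTranslationInvariant (G := G) H) (x : G) :
    translation hL2 hinv x (kernelVector H 1) = kernelVector H x := by
  refine ext_inner_right ℂ fun f => ?_
  have hf : translation hL2 hinv x (translation hL2 hinv x⁻¹ f) = f :=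
    RKHS.ext fun y => by simp [translation_apply]
  conv_lhs => rw [← hf]
  rw [LinearIsometry.inner_map_map, inner_kernelVector, inner_kernelVector, translation_apply]
  simp

lemma kernelVector_apply (hL2 : IsIsometricallyEmbedded H μ)
    (hinv : IsTranslationInvariant (G := G) H) (x y : G) :
    kernelVector H x y = kernelVector H 1 (x⁻¹ * y) := by
  rw [← translation_kernelVector_one hL2 hinv x, translation_apply]

lemma norm_kernelVector (hL2 : IsIsometricallyEmbedded H μ)
    (hinv : IsTranslationInvariant (G := G) H) (x : G) :
    ‖kernelVector H x‖ = ‖kernelVector H (1 : G)‖ := by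
  rw [← translation_kernelVector_one hL2 hinv x, LinearIsometry.norm_map]

lemma enorm_kernelVector (hL2 : IsIsometricallyEmbedded H μ)
    (hinv : IsTranslationInvariant (G := G) H) (x : G) :
    ‖kernelVector H x‖ₑ = ‖kernelVector H (1 : G)‖ₑ := by
  rw [← ofReal_norm, ← ofReal_norm, norm_kernelVector hL2 hinv]

lemma enorm_sq_eq_lintegral (hL2 : IsIsometricallyEmbedded H μ) (f : H) :
    ‖f‖ₑ ^ 2 = ∫⁻ x, ‖f x‖ₑ ^ 2 ∂μ := by
  rw [(hL2 f).2]
  simpa using eLpNorm_nnreal_pow_eq_lintegral (p := 2) (f := (f : G → ℂ)) (μ := μ) (by norm_num)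

lemma norm_kernelVector_sub (hL2 : IsIsometricallyEmbedded H μ)
    (hinv : IsTranslationInvariant (G := G) H) (x y : G) :
    ‖kernelVector H x - kernelVector H y‖ =
      ‖kernelVector H (1 : G) - kernelVector H (x⁻¹ * y)‖ := by
  rw [← LinearIsometry.norm_map (translation hL2 hinv x)
    (kernelVector H (1 : G) - kernelVector H (x⁻¹ * y)), map_sub, translation_kernelVector_one]
  congr 2
  refine RKHS.ext fun z => ?_
  rw [translation_apply, kernelVector_apply hL2 hinv y, kernelVector_apply hL2 hinv (x⁻¹ * y)]
  simp [mul_assoc]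

/-- In L² the map x ↦ k_x is an orbit of the regular representation, which is strongly continuous;
the isometric embedding carries this back to H. -/
lemma continuous_kernelVector [T2Space G] [LocallyCompactSpace G] [SecondCountableTopology G]
    (hL2 : IsIsometricallyEmbedded H μ) (hinv : IsTranslationInvariant (G := G) H) :
    Continuous (kernelVector H : G → H) := by
  have h2 : Fact ((2 : ℝ≥0∞) ≠ ∞) := ⟨by norm_num⟩
  let u : Lp ℂ 2 μ := (hL2 (kernelVector H 1)).1.toLp _
  have hu : ∀ x : G, DomMulAct.mk x⁻¹ • u = (hL2 (kernelVector H x)).1.toLp _ := by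
    intro x
    rw [DomMulAct.mk_smul_toLp]
    congr 1
    ext y
    simp [kernelVector_apply hL2 hinv x y]
  have hdist : ∀ x y : G, dist (kernelVector H x) (kernelVector H y)
      = dist (DomMulAct.mk x⁻¹ • u) (DomMulAct.mk y⁻¹ • u) := by
    intro x y
    rw [hu, hu, dist_eq_norm, dist_eq_norm, ← MemLp.toLp_sub, Lp.norm_toLp, ← RKHS.coe_sub,
      ← (hL2 _).2, toReal_enorm]
  have hc : Continuous fun x : G => DomMulAct.mk x⁻¹ • u := by
    have : Continuous fun x : G => DomMulAct.mk x⁻¹ :=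
      DomMulAct.continuous_mk.comp continuous_inv
    exact this.smul continuous_const
  refine continuous_iff_continuousAt.2 fun x => tendsto_iff_dist_tendsto_zero.2 ?_
  simp only [hdist]
  exact tendsto_iff_dist_tendsto_zero.1 (hc.tendsto x)

lemma continuous_coe [T2Space G] [LocallyCompactSpace G] [SecondCountableTopology G]
    (hL2 : IsIsometricallyEmbedded H μ) (hinv : IsTranslationInvariant (G := G) H) (f : H) :
    Continuous (f : G → ℂ) := by
  have h : (f : G → ℂ) = fun x => inner ℂ (kernelVector H x) f :=
    funext fun x => (inner_kernelVector H x f).symm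
  rw [h]
  exact (continuous_kernelVector hL2 hinv).inner continuous_const

/-- The trace formula: the projections of the kernel vectors onto a finite-dimensional subspace
have total mass equal to its dimension. -/
lemma lintegral_enorm_starProjection_kernelVector (hL2 : IsIsometricallyEmbedded H μ)
    (V : Submodule ℂ H) [FiniteDimensional ℂ V] :
    ∫⁻ y, ‖V.starProjection (kernelVector H y)‖ₑ ^ 2 ∂μ = Module.finrank ℂ V := by
  let b := stdOrthonormalBasis ℂ V
  -- Parseval in V: by the reproducing property the coordinates of the projected k_y have absolute
  -- values |b_i(y)|.
  have h : ∀ y : G, ‖V.starProjection (kernelVector H y)‖ₑ ^ 2 = ∑ i, ‖(b i : H) y‖ₑ ^ 2 := by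
    intro y
    have h1 := b.sum_sq_norm_inner_right (V.orthogonalProjectionOnto (kernelVector H y))
    have h2 : ∀ i, ‖inner ℂ (b i) (V.orthogonalProjectionOnto (kernelVector H y))‖
        = ‖(b i : H) y‖ := by
      intro i
      rw [Submodule.inner_orthogonalProjectionOnto_eq_of_mem_left, norm_inner_symm,
        inner_kernelVector]
    simp only [h2] at h1
    have h3 : ‖V.starProjection (kernelVector H y)‖
        = ‖V.orthogonalProjectionOnto (kernelVector H y)‖ := rfl
    simp only [← ofReal_norm, h3, ← ENNReal.ofReal_pow (norm_nonneg _), ← h1]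
    rw [ENNReal.ofReal_sum_of_nonneg fun i _ => by positivity]
  simp only [h]
  rw [lintegral_finsetSum' _ fun i _ => (hL2 (b i : H)).1.1.enorm.pow_const 2]
  have h1 : ∀ i, ∫⁻ y, ‖(b i : H) y‖ₑ ^ 2 ∂μ = 1 := by
    intro i
    rw [← enorm_sq_eq_lintegral hL2, ← ofReal_norm, ← Submodule.coe_norm, b.norm_eq_one]
    simp
  simp [h1]

end Kernel

/-! ### Counting points by the measure of their neighbourhoods -/

section Counting

variable {G : Type*} [Group G] [TopologicalSpace G] [IsTopologicalGroup G] [MeasurableSpace G]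
  [BorelSpace G]

/-- Every point belongs to at most `N` of the translates `l • U` with `l ∈ Λ`. -/
def HasOverlapBound (Λ U : Set G) (N : ℕ) : Prop :=
  ∀ t : G, (Λ ∩ {l | l⁻¹ * t ∈ U}).encard ≤ N

lemma HasOverlapBound.mono {Λ U V : Set G} {N : ℕ} (h : HasOverlapBound Λ U N) (hVU : V ⊆ U) :
    HasOverlapBound Λ V N := fun t =>
  (encard_le_encard (inter_subset_inter_right Λ
    (show {l : G | l⁻¹ * t ∈ V} ⊆ {l | l⁻¹ * t ∈ U} from fun _ hl => hVU hl))).trans (h t)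

variable {μ : Measure G} [μ.IsHaarMeasure]

/-- Each φ(l) μ(U) is at most the integral of g over lU, by left invariance. For l in A these
translates lie in AU and cover each point at most N times. -/
lemma tsum_mul_measure_le {Λ U : Set G} {N : ℕ} (hN : HasOverlapBound Λ U N) (hU : IsOpen U)
    (A : Set G) {φ g : G → ℝ≥0∞} (hg : Measurable g)
    (hφ : ∀ l s : G, l⁻¹ * s ∈ U → φ l ≤ g s) :
    (∑' l : (Λ ∩ A : Set G), φ l) * μ U ≤ N * ∫⁻ s in A * U, g s ∂μ := by
  have hAU : MeasurableSet (A * U) := hU.mul_left.measurableSet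
  have hlU : ∀ l : G, MeasurableSet (l • U) := fun l => (hU.smul l).measurableSet
  rw [ENNReal.tsum_eq_iSup_sum, ENNReal.iSup_mul]
  refine iSup_le fun J => ?_
  have h1 : ∀ l : G, φ l * μ U ≤ ∫⁻ s, (l • U).indicator g s ∂μ := by
    intro l
    rw [lintegral_indicator (hlU l), ← measure_smul μ l U, ← setLIntegral_const]
    refine setLIntegral_mono hg fun s hs => hφ l s ?_
    rwa [mem_smul_set_iff_inv_smul_mem] at hs
  rw [Finset.sum_mul]
  refine (Finset.sum_le_sum fun (l : (Λ ∩ A : Set G)) _ => h1 l).trans ?_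
  rw [← lintegral_finsetSum J fun (l : (Λ ∩ A : Set G)) _ => hg.indicator (hlU l), ← lintegral_indicator hAU,
    ← lintegral_const_mul _ (hg.indicator hAU)]
  refine lintegral_mono fun s => ?_
  classical
  have h2 : ∀ l ∈ J, ((l : G) • U).indicator g s =
      if (l : G)⁻¹ * s ∈ U then (A * U).indicator g s else 0 := by
    intro l _
    have hiff : s ∈ (l : G) • U ↔ (l : G)⁻¹ * s ∈ U := by
      rw [mem_smul_set_iff_inv_smul_mem]; rfl
    split_ifs with h
    · rw [indicator_of_mem (hiff.2 h), indicator_of_mem]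
      exact ⟨l, l.2.2, _, h, by simp⟩
    · rw [indicator_of_notMem (mt hiff.1 h)]
  rw [Finset.sum_congr rfl h2, ← Finset.sum_filter, Finset.sum_const, nsmul_eq_mul]
  gcongr
  have h3 : (((J.filter fun l : (Λ ∩ A : Set G) => (l : G)⁻¹ * s ∈ U).map
      (Function.Embedding.subtype _) : Finset G) : Set G) ⊆ Λ ∩ {l | l⁻¹ * s ∈ U} := by
    intro l hl
    simp only [Finset.coe_map, Finset.coe_filter, Function.Embedding.coe_subtype, mem_image] at hl
    obtain ⟨l', hl', rfl⟩ := hl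
    exact ⟨l'.2.1, hl'.2⟩
  have h4 := (encard_le_encard h3).trans (hN s)
  rw [encard_coe_eq_coe_finsetCard, Finset.card_map] at h4
  exact_mod_cast h4

lemma encard_mul_measure_le {Λ U : Set G} {N : ℕ} (hN : HasOverlapBound Λ U N) (hU : IsOpen U)
    (A : Set G) : ((Λ ∩ A).encard : ℝ≥0∞) * μ U ≤ N * μ (A * U) := by
  have h := tsum_mul_measure_le (μ := μ) hN hU A (φ := fun _ => 1) (g := fun _ => 1)
    measurable_const fun _ _ _ => le_rfl
  simpa [ENNReal.tsum_set_one] using h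

lemma finite_inter_of_hasOverlapBound (μ : Measure G) [μ.IsHaarMeasure] {Λ U : Set G} {N : ℕ} (hN : HasOverlapBound Λ U N)
    (hU : IsOpen U) (hU1 : (1 : G) ∈ U) {C A : Set G} (hC : IsCompact C) (hUC : U ⊆ C)
    (hA : IsCompact A) : (Λ ∩ A).Finite := by
  by_contra hinf
  have h := encard_mul_measure_le (μ := μ) hN hU A
  rw [encard_eq_top_iff.2 hinf, ENat.toENNReal_top,
    ENNReal.top_mul (hU.measure_pos μ ⟨1, hU1⟩).ne'] at h
  refine (ENNReal.mul_lt_top (ENNReal.natCast_lt_top N) ?_).not_ge h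
  exact (measure_mono (mul_subset_mul_left hUC)).trans_lt (hA.mul hC).measure_lt_top

/-- Thickening the K-boundary of F by C lands in its KC-boundary, so the strong Følner condition
still applies. -/
lemma encard_boundary_mul_measure_le {Λ U : Set G} {N : ℕ} (hN : HasOverlapBound Λ U N)
    (hU : IsOpen U) {C F K S : Set G} (hUC : U ⊆ C) (hS : S ⊆ (F * K) ∩ (Fᶜ * K)) (x : G) :
    ((Λ ∩ x • S).encard : ℝ≥0∞) * μ U ≤ N * μ ((F * (K * C)) ∩ (Fᶜ * (K * C))) := by
  refine (encard_mul_measure_le (μ := μ) hN hU (x • S)).trans ?_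
  rw [smul_mul_assoc, measure_smul]
  gcongr
  rw [← mul_assoc, ← mul_assoc]
  exact (mul_subset_mul hS hUC).trans inter_mul_subset

lemma exists_isCompact_setLIntegral_compl_lt [T2Space G] [LocallyCompactSpace G]
    [SecondCountableTopology G] {g : G → ℝ≥0∞} (hg : ∫⁻ x, g x ∂μ ≠ ∞) {ε : ℝ≥0∞} (hε : 0 < ε) :
    ∃ K : Set G, IsCompact K ∧ (1 : G) ∈ K ∧ ∫⁻ x in Kᶜ, g x ∂μ < ε := by
  have h := tendsto_measure_iInter_atTop (μ := μ.withDensity g)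
    (s := fun n => (compactCovering G n)ᶜ)
    (fun n => (isCompact_compactCovering G n).measurableSet.compl.nullMeasurableSet)
    (fun m n h => compl_subset_compl.2 (compactCovering_subset G h))
    ⟨0, ((measure_mono (subset_univ _)).trans_lt (by
      rw [withDensity_apply _ MeasurableSet.univ, setLIntegral_univ]; exact hg.lt_top)).ne⟩
  rw [← compl_iUnion, iUnion_compactCovering, compl_univ, measure_empty] at h
  obtain ⟨n, hn⟩ := (h.eventually (gt_mem_nhds hε)).exists
  rw [Function.comp_apply,
    withDensity_apply _ (isCompact_compactCovering G n).measurableSet.compl] at hn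
  -- Adjoining 1 only shrinks the complement; later boundary arguments need 1 ∈ K.
  refine ⟨compactCovering G n ∪ {1}, (isCompact_compactCovering G n).union isCompact_singleton,
    by simp, (lintegral_mono_set ?_).trans_lt hn⟩
  exact compl_subset_compl.2 subset_union_left

end Counting

/-! ### Two Hilbert space estimates -/

lemma enorm_sq_eq_tsum {ι : Type*} (c : lp (fun _ : ι => ℂ) 2) :
    ‖c‖ₑ ^ 2 = ∑' i, ‖c i‖ₑ ^ 2 := by
  have h := lp.norm_rpow_eq_tsum (by norm_num) c
  have hs := (lp.memℓp c).summable (by norm_num)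
  simp only [ENNReal.toReal_ofNat, Real.rpow_ofNat] at h hs
  simp only [← ofReal_norm, ← ENNReal.ofReal_pow (norm_nonneg _)]
  rw [h, ENNReal.ofReal_tsum_of_nonneg (fun i => by positivity) hs]

lemma enorm_sq_le_enorm_starProjection_sq_add {H : Type*} [NormedAddCommGroup H]
    [InnerProductSpace ℂ H] (V : Submodule ℂ H) [V.HasOrthogonalProjection] (u v : H)
    (hv : v ∈ V) : ‖u‖ₑ ^ 2 ≤ ‖V.starProjection u‖ₑ ^ 2 + ‖u - v‖ₑ ^ 2 := by
  have h1 := Submodule.norm_sq_eq_add_norm_sq_projection u V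
  have h2 : ‖Vᗮ.orthogonalProjectionOnto u‖ ≤ ‖u - v‖ := by
    have h3 : Vᗮ.orthogonalProjectionOnto u = Vᗮ.orthogonalProjectionOnto (u - v) := by
      rw [map_sub, Submodule.orthogonalProjectionOnto_orthogonal_apply_eq_zero hv, sub_zero]
    rw [h3]
    exact Submodule.norm_orthogonalProjectionOnto_apply_le _ _
  have h4 : ‖V.starProjection u‖ = ‖V.orthogonalProjectionOnto u‖ := rfl
  simp only [← ofReal_norm, ← ENNReal.ofReal_pow (norm_nonneg _)]
  rw [← ENNReal.ofReal_add (by positivity) (by positivity), h4]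
  apply ENNReal.ofReal_le_ofReal
  rw [h1]
  gcongr

/-! ### Sampling sets: lower bound for the number of points -/

section Sampling

variable {G : Type*} {H : Type*} [NormedAddCommGroup H] [InnerProductSpace ℂ H]
  [CompleteSpace H] [RKHS ℂ H G ℂ]

/-- The lower sampling inequality makes restriction to Λ injective with closed range; R projects
orthogonally onto that range and then inverts. -/
lemma exists_leftInverse_of_isSamplingSet {Λ : Set G} (hΛ : IsSamplingSet H Λ) :
    ∃ (C : H →L[ℂ] lp (fun _ : Λ => ℂ) 2) (R : lp (fun _ : Λ => ℂ) 2 →L[ℂ] H),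
      (∀ (f : H) (l : Λ), C f l = f (l : G)) ∧ ∀ f, R (C f) = f := by
  obtain ⟨A, B, hA, hB, hAB⟩ := hΛ
  have hmem : ∀ f : H, Memℓp (fun l : Λ => f (l : G)) 2 := by
    intro f
    refine memℓp_gen ?_
    have h : ∑' l : Λ, ‖f (l : G)‖ₑ ^ 2 ≠ ∞ :=
      ((hAB f).2.trans_lt (ENNReal.mul_lt_top ENNReal.ofReal_lt_top (by simp))).ne
    have h' := ENNReal.summable_toReal h
    simpa using h'
  let C₀ : H →ₗ[ℂ] lp (fun _ : Λ => ℂ) 2 :=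
    { toFun := fun f => ⟨fun l => f (l : G), hmem f⟩
      map_add' := fun f g => by ext l; simp; rfl
      map_smul' := fun c f => by ext l; simp }
  have hC₀ : ∀ (f : H) (l : Λ), C₀ f l = f (l : G) := fun _ _ => rfl
  have hnorm : ∀ f, A * ‖f‖ ^ 2 ≤ ‖C₀ f‖ ^ 2 ∧ ‖C₀ f‖ ^ 2 ≤ B * ‖f‖ ^ 2 := by
    intro f
    have h := hAB f
    simp only [← hC₀] at h
    rw [← enorm_sq_eq_tsum] at h
    simpa only [← ofReal_norm, ← ENNReal.ofReal_pow (norm_nonneg _), ← ENNReal.ofReal_mul hA.le,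
      ← ENNReal.ofReal_mul hB.le, ENNReal.ofReal_le_ofReal_iff (sq_nonneg ‖C₀ f‖),
      ENNReal.ofReal_le_ofReal_iff (mul_nonneg hB.le (sq_nonneg ‖f‖))] using h
  let C : H →L[ℂ] lp (fun _ : Λ => ℂ) 2 := C₀.mkContinuous (√B) fun f => by
    rw [← Real.sqrt_sq (norm_nonneg (C₀ f)), ← Real.sqrt_sq (norm_nonneg f), ← Real.sqrt_mul hB.le]
    exact Real.sqrt_le_sqrt (hnorm f).2
  have hC : ∀ f, C f = C₀ f := fun _ => rfl
  have hanti : AntilipschitzWith (Real.toNNReal (√A)⁻¹) C := by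
    refine ContinuousLinearMap.antilipschitz_of_bound C fun f => ?_
    rw [Real.coe_toNNReal _ (by positivity), inv_mul_eq_div, le_div_iff₀ (by positivity), mul_comm,
      hC, ← Real.sqrt_sq (norm_nonneg (C₀ f)), ← Real.sqrt_sq (norm_nonneg f),
      ← Real.sqrt_mul hA.le]
    exact Real.sqrt_le_sqrt (hnorm f).1
  have hcl : IsClosed (Set.range C) := hanti.isClosed_range C.uniformContinuous
  have hcl' : IsClosed (C.range : Set (lp (fun _ : Λ => ℂ) 2)) := hcl
  have : CompleteSpace C.range := hcl'.completeSpace_coe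
  refine ⟨C, (C.equivRange hanti.injective hcl).symm.toContinuousLinearMap ∘L
    C.range.orthogonalProjectionOnto, fun f l => hC₀ f l, fun f => ?_⟩
  have h : C.range.orthogonalProjectionOnto (C f) = ⟨C f, by simp⟩ :=
    Submodule.orthogonalProjectionOnto_mem_subspace_eq_self (K := C.range) ⟨C f, by simp⟩
  rw [ContinuousLinearMap.comp_apply, h]
  exact ContinuousLinearMap.equivRange_symm_apply hanti.injective hcl f

variable [Group G] [TopologicalSpace G] [IsTopologicalGroup G] [MeasurableSpace G] [BorelSpace G]
  [T2Space G] [LocallyCompactSpace G] [SecondCountableTopology G]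
  {μ : Measure G} [μ.IsHaarMeasure]

/-- The upper sampling inequality is tested on k_t: near t its values exceed c = |k_1(1)|/2 in
modulus, while ‖k_t‖ does not depend on t. -/
lemma exists_hasOverlapBound_of_isSamplingSet (hL2 : IsIsometricallyEmbedded H μ)
    (hinv : IsTranslationInvariant (G := G) H) (hk : kernelVector H (1 : G) ≠ 0)
    {Λ : Set G} (hΛ : IsSamplingSet H Λ) :
    ∃ U : Set G, IsOpen U ∧ 1 ∈ U ∧ ∃ N : ℕ, HasOverlapBound Λ U N := by
  obtain ⟨A, B, hA, hB, hAB⟩ := hΛ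
  have hk1 : ‖kernelVector H (1 : G) 1‖ₑ ≠ 0 := by
    rw [enorm_ne_zero, kernelVector_apply_eq_inner]
    exact inner_self_ne_zero.2 hk
  set c := ‖kernelVector H (1 : G) 1‖ₑ / 2 with hc
  have hc0 : c ≠ 0 := by simpa [hc] using hk1
  have hcont : Continuous fun s : G => ‖kernelVector H (1 : G) s⁻¹‖ₑ :=
    ((continuous_coe hL2 hinv _).comp continuous_inv).enorm
  obtain ⟨N, hN⟩ := ENNReal.exists_nat_gt (r := ENNReal.ofReal B * ‖kernelVector H (1 : G)‖ₑ ^ 2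
    / c ^ 2) (ENNReal.div_lt_top (ENNReal.mul_lt_top ENNReal.ofReal_lt_top (by simp)).ne
      (pow_ne_zero _ hc0)).ne
  refine ⟨{s | c < ‖kernelVector H (1 : G) s⁻¹‖ₑ}, isOpen_lt continuous_const hcont, ?_, N,
    fun t => ?_⟩
  · simpa [hc] using ENNReal.half_lt_self hk1 (by simp)
  set S := Λ ∩ {l | l⁻¹ * t ∈ {s | c < ‖kernelVector H (1 : G) s⁻¹‖ₑ}} with hS
  have h1 : (S.encard : ℝ≥0∞) * c ^ 2 ≤ ENNReal.ofReal B * ‖kernelVector H (1 : G)‖ₑ ^ 2 := by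
    rw [← enorm_kernelVector hL2 hinv t]
    refine le_trans ?_ (hAB (kernelVector H t)).2
    calc (S.encard : ℝ≥0∞) * c ^ 2 = ∑' _ : S, c ^ 2 := by rw [ENNReal.tsum_set_const]
      _ ≤ ∑' l : S, ‖kernelVector H t (l : G)‖ₑ ^ 2 := by
        refine ENNReal.tsum_le_tsum fun l => ?_
        have hl : c < ‖kernelVector H (1 : G) ((l : G)⁻¹ * t)⁻¹‖ₑ := l.2.2
        rw [kernelVector_apply hL2 hinv t]
        rw [mul_inv_rev, inv_inv] at hl
        gcongr
      _ ≤ ∑' l : Λ, ‖kernelVector H t (l : G)‖ₑ ^ 2 :=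
        ENNReal.tsum_mono_subtype (fun l => ‖kernelVector H t l‖ₑ ^ 2) inter_subset_left
  have h2 : (S.encard : ℝ≥0∞) ≤ N := by
    refine le_trans ?_ hN.le
    rwa [ENNReal.le_div_iff_mul_le (Or.inl (pow_ne_zero _ hc0))
      (Or.inl (by simp [hc, ENNReal.div_eq_top]))]
  exact_mod_cast h2

/-- Kernel vectors are uniformly concentrated, as sequences on `Λ`. -/
lemma exists_isCompact_tsum_kernelVector_le (hL2 : IsIsometricallyEmbedded H μ)
    (hinv : IsTranslationInvariant (G := G) H) (hloc : IsLocalized H μ) {Λ U : Set G} {N : ℕ}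
    (hN : HasOverlapBound Λ U N) (hU : IsOpen U) (hU1 : (1 : G) ∈ U) {δ : ℝ≥0∞} (hδ : 0 < δ) :
    ∃ K : Set G, IsCompact K ∧ 1 ∈ K ∧ ∀ y : G,
      ∑' l : (Λ ∩ {l | y⁻¹ * l ∉ K} : Set G), ‖kernelVector H y (l : G)‖ₑ ^ 2 ≤ δ := by
  obtain ⟨Q, hQc, hQ1, hQ⟩ := hloc
  -- W ⊆ Q gives finite measure; W⁻¹ ⊆ Q gives l ∈ sQ whenever l⁻¹s ∈ W, so the local supremum at s
  -- dominates the value at l.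
  set W := U ∩ (interior Q ∩ (interior Q)⁻¹) with hW
  have hWo : IsOpen W := hU.inter (isOpen_interior.inter isOpen_interior.inv)
  have hQ1' : (1 : G) ∈ interior Q := mem_interior_iff_mem_nhds.2 hQ1
  have hW1 : (1 : G) ∈ W := ⟨hU1, hQ1', by simpa using hQ1'⟩
  have hNW : HasOverlapBound Λ W N := hN.mono inter_subset_left
  set g : G → ℝ≥0∞ := fun s => ⨆ t ∈ s • Q, ‖kernelVector H (1 : G) t‖ₑ ^ 2 with hg
  have hg' : g = fun s => ⨆ u ∈ Q, ‖kernelVector H (1 : G) (s * u)‖ₑ ^ 2 := by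
    ext s
    simp only [hg, ← image_smul, iSup_image, smul_eq_mul]
  have hgm : Measurable g := by
    rw [hg']
    refine LowerSemicontinuous.measurable (lowerSemicontinuous_biSup fun u _ => ?_)
    refine Continuous.lowerSemicontinuous ?_
    have : Continuous fun s : G => ‖kernelVector H (1 : G) (s * u)‖ₑ :=
      ((continuous_coe hL2 hinv _).comp (continuous_mul_const u)).enorm
    exact (ENNReal.continuous_pow 2).comp this
  have hWpos : 0 < μ W := hWo.measure_pos μ ⟨1, hW1⟩
  have hWtop : μ W ≠ ∞ :=
    ((measure_mono fun x hx => interior_subset hx.2.1).trans_lt hQc.measure_lt_top).ne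
  -- This tolerance absorbs the factors N and μ(W) of the counting estimate; N + 1 avoids division
  -- by zero.
  obtain ⟨K, hK, hK1, hgK⟩ := exists_isCompact_setLIntegral_compl_lt (μ := μ) (g := g)
    (hQ (kernelVector H 1)).ne (ε := δ * μ W / (N + 1))
    (ENNReal.div_pos (mul_ne_zero hδ.ne' hWpos.ne') (by finiteness))
  -- The factor Q absorbs the neighbourhood W: if y⁻¹l ∉ KQ and w ∈ W, then y⁻¹lw ∉ K.
  refine ⟨K * Q, hK.mul hQc, ⟨1, hK1, 1, mem_of_mem_nhds hQ1, by simp⟩, fun y => ?_⟩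
  have h1 := tsum_mul_measure_le (μ := μ) hNW hWo {l | y⁻¹ * l ∉ K * Q}
    (φ := fun l => ‖kernelVector H y l‖ₑ ^ 2) (g := fun s => g (y⁻¹ * s))
    (hgm.comp (measurable_const_mul _)) (fun l s hls => by
      have hq : (l⁻¹ * s)⁻¹ ∈ Q := interior_subset hls.2.2
      rw [hg']
      refine le_trans (le_of_eq ?_) (le_biSup
        (fun u => ‖kernelVector H (1 : G) (y⁻¹ * s * u)‖ₑ ^ 2) hq)
      rw [kernelVector_apply hL2 hinv y]
      simp [mul_assoc])
  have h2 : ∫⁻ s in {l | y⁻¹ * l ∉ K * Q} * W, g (y⁻¹ * s) ∂μ ≤ ∫⁻ s in Kᶜ, g s ∂μ := by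
    rw [← lintegral_indicator hWo.mul_left.measurableSet,
      ← lintegral_indicator hK.measurableSet.compl, ← lintegral_mul_left_eq_self (Kᶜ.indicator g) y⁻¹]
    refine lintegral_mono fun s => ?_
    by_cases hs : s ∈ {l | y⁻¹ * l ∉ K * Q} * W
    swap
    · simp [indicator_of_notMem hs]
    rw [indicator_of_mem hs, indicator_of_mem]
    obtain ⟨l, hl, w, hw, rfl⟩ := hs
    intro hmem
    refine hl ⟨_, hmem, w⁻¹, interior_subset hw.2.2, ?_⟩
    simp [mul_assoc]
  have h3 : (∑' l : (Λ ∩ {l | y⁻¹ * l ∉ K * Q} : Set G), ‖kernelVector H y (l : G)‖ₑ ^ 2) * μ W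
      ≤ δ * μ W :=
    calc _ ≤ (N : ℝ≥0∞) * ∫⁻ s in Kᶜ, g s ∂μ := h1.trans (mul_le_mul_right h2 _)
      _ ≤ (N + 1) * (δ * μ W / (N + 1)) := by
        gcongr
        exact le_self_add
      _ = δ * μ W := ENNReal.mul_div_cancel (by simp) (by finiteness)
  exact (ENNReal.mul_le_mul_iff_left hWpos.ne' hWtop).1 h3

lemma exists_isCompact_mul_measure_le_encard (hL2 : IsIsometricallyEmbedded H μ)
    (hinv : IsTranslationInvariant (G := G) H) (hloc : IsLocalized H μ) {Λ U : Set G} {N : ℕ}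
    (hΛ : IsSamplingSet H Λ) (hN : HasOverlapBound Λ U N) (hU : IsOpen U) (hU1 : (1 : G) ∈ U)
    {C : Set G} (hC : IsCompact C) (hUC : U ⊆ C) {ε : ℝ≥0∞} (hε : 0 < ε) :
    ∃ K : Set G, IsCompact K ∧ 1 ∈ K ∧ ∀ (F : Set G), IsCompact F → ∀ x : G,
      ‖kernelVector H (1 : G)‖ₑ ^ 2 * μ F ≤
        ((Λ ∩ x • (F * K)).encard : ℝ≥0∞) + ε * μ F := by
  obtain ⟨S, R, hS, hRS⟩ := exists_leftInverse_of_isSamplingSet hΛ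
  obtain ⟨K, hK, hK1, hKt⟩ := exists_isCompact_tsum_kernelVector_le hL2 hinv hloc hN hU hU1
    (δ := ε / (‖R‖ₑ ^ 2 + 1)) (ENNReal.div_pos hε.ne' (by finiteness))
  refine ⟨K, hK, hK1, fun F hF x => ?_⟩
  have hfin : (Λ ∩ x • (F * K)).Finite :=
    finite_inter_of_hasOverlapBound μ hN hU hU1 hC hUC ((hF.mul hK).smul x)
  classical
  let J : Finset Λ := hfin.toFinset.subtype (· ∈ Λ)
  have hJ : ∀ l : Λ, l ∈ J ↔ (l : G) ∈ x • (F * K) := fun l => by simp [J]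
  have hJcard : (J.card : ℝ≥0∞) ≤ (Λ ∩ x • (F * K)).encard := by
    have : J.card ≤ hfin.toFinset.card := by
      rw [Finset.card_subtype]
      exact Finset.card_filter_le _ _
    rw [hfin.encard_eq_coe_toFinset_card]
    exact_mod_cast this
  let V : Submodule ℂ H := Submodule.span ℂ (J.image fun l : Λ => R (lp.single (E := fun _ : Λ => ℂ) 2 l (1 : ℂ)) : Finset H)
  have hdim : (Module.finrank ℂ V : ℝ≥0∞) ≤ J.card := by
    exact_mod_cast (finrank_span_finset_le_card _).trans Finset.card_image_le
  have hdist : ∀ y ∈ x • F, ‖kernelVector H (1 : G)‖ₑ ^ 2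
      ≤ ‖V.starProjection (kernelVector H y)‖ₑ ^ 2 + ε := by
    intro y hy
    let c := S (kernelVector H y)
    -- For y ∈ xF, every l with y⁻¹l ∈ K lies in xFK, so truncating to J discards only the uniformly
    -- small tail; R c' is the approximant of k_y in V.
    let c' : lp (fun _ : Λ => ℂ) 2 := ∑ l ∈ J, lp.single 2 l (c l)
    have hc' : R c' ∈ V := by
      rw [map_sum]
      refine Submodule.sum_mem _ fun l hl => ?_
      have : lp.single (E := fun _ : Λ => ℂ) 2 l (c l)
          = c l • lp.single (E := fun _ : Λ => ℂ) 2 l (1 : ℂ) := by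
        rw [← lp.single_smul]; simp
      rw [this, map_smul]
      exact Submodule.smul_mem _ _ (Submodule.subset_span
        (Finset.mem_coe.2 (Finset.mem_image_of_mem _ hl)))
    have hcc : ‖c - c'‖ₑ ^ 2 ≤ ε / (‖R‖ₑ ^ 2 + 1) := by
      refine le_trans ?_ (hKt y)
      rw [enorm_sq_eq_tsum]
      have hterm : ∀ l : Λ, ‖(c - c') l‖ₑ ^ 2 ≤
          (Λ ∩ {l | y⁻¹ * l ∉ K}).indicator (fun l => ‖kernelVector H y l‖ₑ ^ 2) (l : G) := by
        intro l
        have hc'l : c' l = if l ∈ J then c l else 0 := by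
          simp only [c', lp.coeFn_sum, Finset.sum_apply, lp.single_apply]
          simp [Pi.single_apply]
        rw [lp.coeFn_sub, Pi.sub_apply, hc'l]
        split_ifs with hl
        · simp
        · rw [indicator_of_mem, sub_zero, hS]
          refine ⟨l.2, fun hlK => hl ((hJ l).2 ?_)⟩
          rw [← smul_mul_assoc]
          exact ⟨y, hy, _, hlK, by simp⟩
      calc _ ≤ ∑' l : Λ, (Λ ∩ {l | y⁻¹ * l ∉ K}).indicator
            (fun l => ‖kernelVector H y l‖ₑ ^ 2) (l : G) := ENNReal.tsum_le_tsum hterm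
        _ ≤ ∑' l : G, (Λ ∩ {l | y⁻¹ * l ∉ K}).indicator (fun l => ‖kernelVector H y l‖ₑ ^ 2) l :=
          ENNReal.tsum_comp_le_tsum_of_injective Subtype.val_injective _
        _ = _ := (tsum_subtype _ _).symm
    rw [← enorm_kernelVector hL2 hinv y]
    refine (enorm_sq_le_enorm_starProjection_sq_add V _ (R c') hc').trans ?_
    gcongr
    calc ‖kernelVector H y - R c'‖ₑ ^ 2 = ‖R (c - c')‖ₑ ^ 2 := by rw [map_sub, hRS]
      _ ≤ (‖R‖ₑ * ‖c - c'‖ₑ) ^ 2 := by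
        gcongr
        exact R.le_opENorm _
      _ ≤ (‖R‖ₑ ^ 2 + 1) * (ε / (‖R‖ₑ ^ 2 + 1)) := by
        rw [mul_pow]
        gcongr
        exact le_self_add
      _ = ε := ENNReal.mul_div_cancel (by simp) (by finiteness)
  have hxF : MeasurableSet (x • F) := (hF.smul x).measurableSet
  calc ‖kernelVector H (1 : G)‖ₑ ^ 2 * μ F
      = ∫⁻ _ in x • F, ‖kernelVector H (1 : G)‖ₑ ^ 2 ∂μ := by rw [setLIntegral_const, measure_smul]
    _ ≤ ∫⁻ y in x • F, (‖V.starProjection (kernelVector H y)‖ₑ ^ 2 + ε) ∂μ :=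
      setLIntegral_mono' hxF hdist
    _ = ∫⁻ y in x • F, ‖V.starProjection (kernelVector H y)‖ₑ ^ 2 ∂μ + ε * μ F := by
      rw [lintegral_add_right _ measurable_const, setLIntegral_const, measure_smul]
    _ ≤ ((Λ ∩ x • (F * K)).encard : ℝ≥0∞) + ε * μ F := by
      gcongr
      refine (setLIntegral_le_lintegral _ _).trans ?_
      rw [lintegral_enorm_starProjection_kernelVector hL2]
      exact hdim.trans hJcard

end Sampling

/-! ### Interpolation sets: upper bound for the number of points -/

section Interpolation

variable {G : Type*} {H : Type*} [NormedAddCommGroup H] [InnerProductSpace ℂ H]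
  [CompleteSpace H] [RKHS ℂ H G ℂ]

/-- Open mapping theorem for the projection to ℓ²(Λ) of the closed space of pairs (f, c) with f|Λ =
c. Passing to pairs avoids assuming that every f restricts to ℓ²(Λ). -/
lemma exists_norm_le_of_isInterpolationSet {Λ : Set G} (hΛ : IsInterpolationSet H Λ) :
    ∃ M : ℝ, 0 < M ∧ ∀ c : lp (fun _ : Λ => ℂ) 2, ∃ f : H,
      (∀ l : Λ, f (l : G) = c l) ∧ ‖f‖ ≤ M * ‖c‖ := by
  let p : Submodule ℂ (H × lp (fun _ : Λ => ℂ) 2) :=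
    { carrier := {q | ∀ l : Λ, q.1 (l : G) = q.2 l}
      add_mem' := fun {a b} ha hb l => by simp [ha l, hb l]
      zero_mem' := fun l => by simp
      smul_mem' := fun c a ha l => by simp [ha l] }
  have hp : IsClosed (p : Set (H × lp (fun _ : Λ => ℂ) 2)) := by
    have : (p : Set (H × lp (fun _ : Λ => ℂ) 2)) = ⋂ l : Λ, {q | q.1 (l : G) = q.2 l} := by
      ext q; simp [p]
    rw [this]
    refine isClosed_iInter fun l => isClosed_eq ?_ ?_
    · exact (RKHS.continuous_eval (H := H) (l : G)).comp continuous_fst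
    · exact ((continuous_apply l).comp lp.uniformContinuous_coe.continuous).comp continuous_snd
  have : CompleteSpace p := hp.completeSpace_coe
  let T : p →L[ℂ] lp (fun _ : Λ => ℂ) 2 := ContinuousLinearMap.snd ℂ _ _ ∘L p.subtypeL
  have hT : Function.Surjective T := fun c => by
    obtain ⟨f, hf⟩ := hΛ c
    exact ⟨⟨(f, c), hf⟩, rfl⟩
  obtain ⟨M, hM, h⟩ := T.exists_preimage_norm_le hT
  refine ⟨M, hM, fun c => ?_⟩
  obtain ⟨q, rfl, hq⟩ := h c
  exact ⟨q.1.1, q.2, (norm_fst_le q.1).trans hq⟩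

lemma linearIndependent_kernelVector {Λ : Set G} (hΛ : IsInterpolationSet H Λ) :
    LinearIndependent ℂ fun l : Λ => kernelVector H (l : G) := by
  classical
  rw [linearIndependent_iff']
  intro s a ha i hi
  obtain ⟨f, hf⟩ := hΛ (lp.single (E := fun _ : Λ => ℂ) 2 i 1)
  have h := congrArg (fun v => inner ℂ f v) ha
  have hterm : ∀ l : Λ, inner ℂ f (a l • kernelVector H (l : G)) = if l = i then a i else 0 := by
    intro l
    rw [inner_smul_right, ← inner_conj_symm, inner_kernelVector, hf, lp.single_apply]
    by_cases hl : l = i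
    · subst hl; simp
    · simp [hl]
  simpa [inner_sum, hterm, hi] using h

/-- The projection onto V depends only on the values at J, so u may be replaced by the
norm-controlled interpolant of those values. -/
lemma enorm_starProjection_span_kernelVector_sq_le {Λ : Set G} {M : ℝ}
    (hM : ∀ c : lp (fun _ : Λ => ℂ) 2, ∃ f : H, (∀ l : Λ, f (l : G) = c l) ∧ ‖f‖ ≤ M * ‖c‖)
    (J : Finset Λ) (V : Submodule ℂ H) [V.HasOrthogonalProjection]
    (hV : V = Submodule.span ℂ (range fun l : J => kernelVector H (l : G))) (u : H) :
    ‖V.starProjection u‖ₑ ^ 2 ≤ ENNReal.ofReal M ^ 2 * ∑ l ∈ J, ‖u (l : G)‖ₑ ^ 2 := by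
  classical
  let c : lp (fun _ : Λ => ℂ) 2 := ∑ l ∈ J, lp.single (E := fun _ : Λ => ℂ) 2 l (u (l : G))
  have hc : ∀ l : Λ, c l = if l ∈ J then u (l : G) else 0 := by
    intro l
    simp only [c, lp.coeFn_sum, Finset.sum_apply, lp.single_apply]
    simp [Pi.single_apply]
  have hcnorm : ‖c‖ₑ ^ 2 = ∑ l ∈ J, ‖u (l : G)‖ₑ ^ 2 := by
    rw [enorm_sq_eq_tsum, tsum_eq_sum (s := J) fun l hl => by simp [hc, hl]]
    exact Finset.sum_congr rfl fun l hl => by simp [hc, hl]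
  obtain ⟨f, hf, hfM⟩ := hM c
  have horth : u - f ∈ Vᗮ := by
    have : V ≤ (Submodule.span ℂ {u - f})ᗮ := by
      rw [hV, Submodule.span_le]
      rintro _ ⟨l, rfl⟩
      rw [SetLike.mem_coe, Submodule.mem_orthogonal_singleton_iff_inner_left, inner_kernelVector]
      simp [hf, hc]
    exact Submodule.le_orthogonal_iff_le_orthogonal.1 this (Submodule.mem_span_singleton_self _)
  have hproj : V.starProjection u = V.starProjection f := by
    rw [← sub_eq_zero, ← map_sub]
    exact (Submodule.starProjection_apply_eq_zero_iff V).2 horth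
  rw [hproj, ← hcnorm, ← mul_pow]
  gcongr
  rw [← ofReal_norm, ← ofReal_norm, ← ENNReal.ofReal_mul' (norm_nonneg _)]
  exact ENNReal.ofReal_le_ofReal ((V.norm_starProjection_apply_le f).trans hfM)

variable [Group G] [TopologicalSpace G] [IsTopologicalGroup G] [MeasurableSpace G] [BorelSpace G]
  [T2Space G] [LocallyCompactSpace G] [SecondCountableTopology G]
  {μ : Measure G} [μ.IsHaarMeasure]

/-- For distinct l, l' in Λ, an f with f(l) = 1, f(l') = 0 and ‖f‖ ≤ M forces 1 ≤ M‖k_l − k_l'‖. By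
continuity and invariance this fails when l⁻¹l' is near 1. -/
lemma exists_hasOverlapBound_of_isInterpolationSet (hL2 : IsIsometricallyEmbedded H μ)
    (hinv : IsTranslationInvariant (G := G) H) {Λ : Set G} (hΛ : IsInterpolationSet H Λ) :
    ∃ U : Set G, IsOpen U ∧ 1 ∈ U ∧ HasOverlapBound Λ U 1 := by
  classical
  obtain ⟨M, hM0, hM⟩ := exists_norm_le_of_isInterpolationSet hΛ
  have hopen : IsOpen {s : G | ‖kernelVector H (1 : G) - kernelVector H s‖ * M < 1} :=
    isOpen_lt ((continuous_const.sub (continuous_kernelVector hL2 hinv)).norm.mul_const M)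
      continuous_const
  obtain ⟨V, hV, hVs⟩ := exists_nhds_split_inv (hopen.mem_nhds (x := 1) (by simp))
  refine ⟨interior V, isOpen_interior, mem_interior_iff_mem_nhds.2 hV, fun t => ?_⟩
  rw [Nat.cast_one, encard_le_one_iff]
  intro l l' hl hl'
  by_contra hne
  obtain ⟨f, hf, hfM⟩ := hM (lp.single (E := fun _ : Λ => ℂ) 2 ⟨l, hl.1⟩ 1)
  have h1 : f l = 1 := by simpa using hf ⟨l, hl.1⟩
  have h2 : f l' = 0 := by
    have := hf ⟨l', hl'.1⟩
    rwa [lp.single_apply_ne _ _ _ (by simpa [Subtype.ext_iff] using Ne.symm hne)] at this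
  have h3 : (1 : ℝ) ≤ ‖kernelVector H l - kernelVector H l'‖ * ‖f‖ := by
    refine le_trans (le_of_eq ?_) (norm_inner_le_norm (𝕜 := ℂ) _ _)
    rw [inner_sub_left, inner_kernelVector, inner_kernelVector, h1, h2]
    simp
  have h4 : ‖f‖ ≤ M := by simpa [lp.norm_single] using hfM
  have h5 := hVs _ (interior_subset hl.2) _ (interior_subset hl'.2)
  rw [mem_ofPred_eq, div_eq_mul_inv, mul_inv_rev, inv_inv, mul_assoc, mul_inv_cancel_left,
    ← norm_kernelVector_sub hL2 hinv] at h5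
  exact (h3.trans (mul_le_mul_of_nonneg_left h4 (norm_nonneg _))).not_gt h5

lemma exists_isCompact_encard_le_mul_measure (hL2 : IsIsometricallyEmbedded H μ)
    (hinv : IsTranslationInvariant (G := G) H) {Λ U : Set G} {N : ℕ}
    (hΛ : IsInterpolationSet H Λ) (hN : HasOverlapBound Λ U N) (hU : IsOpen U)
    (hU1 : (1 : G) ∈ U) {C : Set G} (hC : IsCompact C) (hUC : U ⊆ C) {ε : ℝ≥0∞} (hε : 0 < ε) :
    ∃ K : Set G, IsCompact K ∧ 1 ∈ K ∧ ∀ (F : Set G), IsCompact F → ∀ x : G,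
      ((Λ ∩ x • {t ∈ F | ∀ k ∈ K, t * k ∈ F}).encard : ℝ≥0∞) ≤
        ‖kernelVector H (1 : G)‖ₑ ^ 2 * μ F +
          ε * (Λ ∩ x • {t ∈ F | ∀ k ∈ K, t * k ∈ F}).encard := by
  obtain ⟨M, hM0, hM⟩ := exists_norm_le_of_isInterpolationSet hΛ
  -- Dividing by M² compensates the interpolation constant in the projection estimate.
  obtain ⟨K, hK, hK1, hKε⟩ := exists_isCompact_setLIntegral_compl_lt (μ := μ)
    (g := fun s => ‖kernelVector H (1 : G) s‖ₑ ^ 2)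
    (by rw [← enorm_sq_eq_lintegral hL2]; simp) (ε := ε / (ENNReal.ofReal M ^ 2))
    (ENNReal.div_pos hε.ne' (by finiteness))
  refine ⟨K, hK, hK1, fun F hF x => ?_⟩
  set F' := {t ∈ F | ∀ k ∈ K, t * k ∈ F} with hF'
  have hfin : (Λ ∩ x • F').Finite :=
    (finite_inter_of_hasOverlapBound μ hN hU hU1 hC hUC (hF.smul x)).subset
      (inter_subset_inter_right _ (smul_set_mono (sep_subset _ _)))
  classical
  let J : Finset Λ := hfin.toFinset.subtype (· ∈ Λ)
  have hJ : ∀ l ∈ J, (l : G) ∈ x • F' := fun l hl => by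
    simp only [J, Finset.mem_subtype, Finite.mem_toFinset] at hl
    exact hl.2
  have hJcard : (J.card : ℝ≥0∞) = (Λ ∩ x • F').encard := by
    have : J.card = hfin.toFinset.card := by
      rw [Finset.card_subtype, Finset.filter_true_of_mem]
      intro l hl
      exact ((Finite.mem_toFinset hfin).1 hl).1
    rw [hfin.encard_eq_coe_toFinset_card, this]
    simp
  let V : Submodule ℂ H := Submodule.span ℂ (range fun l : J => kernelVector H (l : G))
  have hdim : Module.finrank ℂ V = J.card := by
    rw [finrank_span_eq_card (b := fun l : J => kernelVector H (l : G))
      ((linearIndependent_kernelVector hΛ).comp _ Subtype.val_injective)]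
    simp
  have hfd : FiniteDimensional ℂ V := FiniteDimensional.span_of_finite ℂ (finite_range _)
  have hxF : MeasurableSet (x • F) := (hF.smul x).measurableSet
  -- Since l ∈ xF' gives lK ⊆ xF, any y outside xF has l⁻¹y ∉ K; only the tail of k_1 contributes.
  have htail : ∀ l ∈ J, ∫⁻ y in (x • F)ᶜ, ‖kernelVector H y (l : G)‖ₑ ^ 2 ∂μ
      ≤ ε / (ENNReal.ofReal M ^ 2) := by
    intro l hl
    refine le_trans ?_ hKε.le
    simp only [enorm_kernelVector_apply_comm _ (l : G), kernelVector_apply hL2 hinv (l : G)]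
    rw [← lintegral_indicator hxF.compl, ← lintegral_indicator hK.measurableSet.compl,
      ← lintegral_mul_left_eq_self (Kᶜ.indicator _) (l : G)⁻¹]
    refine lintegral_mono fun y => ?_
    by_cases hy : y ∈ (x • F)ᶜ
    swap
    · simp [indicator_of_notMem hy]
    rw [indicator_of_mem hy, indicator_of_mem]
    intro hmem
    obtain ⟨t, ht, htl⟩ := hJ l hl
    refine hy ⟨_, ht.2 _ hmem, ?_⟩
    simp only [smul_eq_mul] at htl ⊢
    rw [← mul_assoc, htl, mul_inv_cancel_left]
  rw [← hJcard]
  calc (J.card : ℝ≥0∞) = ∫⁻ y, ‖V.starProjection (kernelVector H y)‖ₑ ^ 2 ∂μ := by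
        rw [lintegral_enorm_starProjection_kernelVector hL2, hdim]
    _ = ∫⁻ y in x • F, ‖V.starProjection (kernelVector H y)‖ₑ ^ 2 ∂μ
        + ∫⁻ y in (x • F)ᶜ, ‖V.starProjection (kernelVector H y)‖ₑ ^ 2 ∂μ :=
      (lintegral_add_compl _ hxF).symm
    _ ≤ ∫⁻ _ in x • F, ‖kernelVector H (1 : G)‖ₑ ^ 2 ∂μ
        + ∫⁻ y in (x • F)ᶜ, ENNReal.ofReal M ^ 2 *
          ∑ l ∈ J, ‖kernelVector H y (l : G)‖ₑ ^ 2 ∂μ := by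
      refine add_le_add (lintegral_mono fun y => ?_) (lintegral_mono fun y => ?_)
      · rw [← enorm_kernelVector hL2 hinv y, ← ofReal_norm, ← ofReal_norm]
        gcongr
        exact V.norm_starProjection_apply_le _
      · exact enorm_starProjection_span_kernelVector_sq_le hM J V rfl _
    _ ≤ ‖kernelVector H (1 : G)‖ₑ ^ 2 * μ F + ε * J.card := by
      rw [setLIntegral_const, measure_smul]
      gcongr
      have hmeas : ∀ l : Λ, Measurable fun y : G => ‖kernelVector H y (l : G)‖ₑ ^ 2 := by
        intro l
        simp only [enorm_kernelVector_apply_comm _ (l : G)]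
        exact (continuous_coe hL2 hinv _).measurable.enorm.pow_const 2
      rw [lintegral_const_mul _ (Finset.measurable_fun_sum _ fun l _ => hmeas l),
        lintegral_finsetSum _ fun l _ => hmeas l]
      refine (mul_le_mul_right (Finset.sum_le_sum htail) _).trans_eq ?_
      rw [Finset.sum_const, nsmul_eq_mul, mul_left_comm,
        ENNReal.mul_div_cancel (by simpa using hM0) (by finiteness), mul_comm]

end Interpolation

/-! ### Følner sequences and comparison of densities -/

section Folner

variable {G : Type*} [Group G] [TopologicalSpace G] [IsTopologicalGroup G] [MeasurableSpace G]
  [BorelSpace G] {μ : Measure G} [μ.IsHaarMeasure] {F : ℕ → Set G}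

lemma lowerBeurlingDensityAlong_le (hF : IsStrongFolner μ F) (Λ : Set G) :
    lowerBeurlingDensityAlong μ F Λ ≤ lowerBeurlingDensity μ Λ :=
  liminf_le_of_le (by isBoundedDefault) fun _ hb => by
    obtain ⟨n, hn⟩ := hb.exists
    exact hn.trans (le_iSup₂_of_le (F n) (hF.isCompact n) (le_iSup_of_le (hF.measure_pos n) le_rfl))

lemma upperBeurlingDensity_le (hF : IsStrongFolner μ F) (Λ : Set G) :
    upperBeurlingDensity μ Λ ≤ upperBeurlingDensityAlong μ F Λ :=
  le_limsup_of_le (by isBoundedDefault) fun _ hb => by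
    obtain ⟨n, hn⟩ := hb.exists
    exact (iInf₂_le_of_le (F n) (hF.isCompact n)
      (iInf_le_of_le (hF.measure_pos n) le_rfl)).trans hn

/-- Points of `Λ` near the boundary of the Følner sets are negligible. -/
lemma exists_tendsto_encard_boundary_le (hF : IsStrongFolner μ F) {Λ U : Set G} {N : ℕ}
    (hN : HasOverlapBound Λ U N) (hU : IsOpen U) (hU1 : (1 : G) ∈ U) {C K : Set G}
    (hC : IsCompact C) (hUC : U ⊆ C) (hK : IsCompact K) :
    ∃ r : ℕ → ℝ≥0∞, Tendsto r atTop (𝓝 0) ∧ ∀ (n : ℕ) (x : G) (S : Set G),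
      S ⊆ (F n * K) ∩ ((F n)ᶜ * K) → ((Λ ∩ x • S).encard : ℝ≥0∞) / μ (F n) ≤ r n := by
  have hU0 : μ U ≠ 0 := (hU.measure_pos μ ⟨1, hU1⟩).ne'
  have hUt : μ U ≠ ∞ := ((measure_mono hUC).trans_lt hC.measure_lt_top).ne
  refine ⟨fun n => N / μ U * (μ ((F n * (K * C)) ∩ ((F n)ᶜ * (K * C))) / μ (F n)), ?_,
    fun n x S hS => ?_⟩
  · simpa using ENNReal.Tendsto.const_mul (hF.tendsto _ (hK.mul hC))
      (Or.inr (ENNReal.div_ne_top (ENNReal.natCast_ne_top N) hU0))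
  · beta_reduce
    rw [← mul_div_assoc]
    gcongr
    rw [← ENNReal.mul_div_right_comm, ENNReal.le_div_iff_mul_le (Or.inl hU0) (Or.inl hUt)]
    exact encard_boundary_mul_measure_le hN hU hUC hS x

lemma encard_le_add_of_subset_union {Λ S T R : Set G} (h : S ⊆ T ∪ R) (x : G) :
    ((Λ ∩ x • S).encard : ℝ≥0∞) ≤ (Λ ∩ x • T).encard + (Λ ∩ x • R).encard := by
  have h1 : Λ ∩ x • S ⊆ (Λ ∩ x • T) ∪ (Λ ∩ x • R) := by
    rw [← inter_union_distrib_left, ← smul_set_union]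
    exact inter_subset_inter_right _ (smul_set_mono h)
  exact_mod_cast (encard_le_encard h1).trans (encard_union_le _ _)

lemma le_of_forall_mul_one_sub_le {L κ : ℝ≥0∞} (hκ : κ ≠ ∞)
    (h : ∀ ε : ℝ≥0∞, 0 < ε → ε < 1 → L * (1 - ε) ≤ κ + ε) : L ≤ κ := by
  have h1 : Tendsto (fun ε : ℝ≥0∞ => (κ + ε) / (1 - ε)) (𝓝[>] 0) (𝓝 κ) := by
    have h2 : Tendsto (fun ε : ℝ≥0∞ => (κ + ε) / (1 - ε)) (𝓝 0) (𝓝 ((κ + 0) / (1 - 0))) :=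
      ENNReal.Tendsto.div (tendsto_const_nhds.add tendsto_id) (by simp)
        (ENNReal.Tendsto.sub tendsto_const_nhds tendsto_id (by simp)) (by simp [hκ])
    simpa using h2.mono_left nhdsWithin_le_nhds
  refine ge_of_tendsto h1 ?_
  filter_upwards [Ioo_mem_nhdsGT (zero_lt_one (α := ℝ≥0∞))] with ε hε
  rw [ENNReal.le_div_iff_mul_le (Or.inl (tsub_pos_of_lt hε.2).ne')
    (Or.inl (by finiteness))]
  exact h ε hε.1 hε.2

end Folner

/-! ### The density inequalities -/

section Density

variable {G : Type*} [Group G] [TopologicalSpace G] [IsTopologicalGroup G] [T2Space G]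
  [LocallyCompactSpace G] [SecondCountableTopology G] [MeasurableSpace G] [BorelSpace G]
  {μ : Measure G} [μ.IsHaarMeasure] {F : ℕ → Set G} {H : Type*} [NormedAddCommGroup H]
  [InnerProductSpace ℂ H] [CompleteSpace H] [RKHS ℂ H G ℂ] {Λ : Set G}

lemma HasOverlapBound.exists_subset_isCompact {Λ U : Set G} {N : ℕ} (hN : HasOverlapBound Λ U N)
    (hU : IsOpen U) (hU1 : (1 : G) ∈ U) :
    ∃ V C : Set G, IsOpen V ∧ 1 ∈ V ∧ IsCompact C ∧ V ⊆ C ∧ HasOverlapBound Λ V N := by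
  obtain ⟨C, hC, hC1⟩ := exists_compact_mem_nhds (1 : G)
  exact ⟨U ∩ interior C, C, hU.inter isOpen_interior,
    ⟨hU1, mem_interior_iff_mem_nhds.2 hC1⟩, hC, inter_subset_right.trans interior_subset,
    hN.mono inter_subset_left⟩

theorem le_lowerBeurlingDensityAlong (hF : IsStrongFolner μ F)
    (hL2 : IsIsometricallyEmbedded H μ) (hinv : IsTranslationInvariant (G := G) H)
    (hloc : IsLocalized H μ) (hΛ : IsSamplingSet H Λ) :
    ‖kernelVector H (1 : G)‖ₑ ^ 2 ≤ lowerBeurlingDensityAlong μ F Λ := by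
  by_cases hk : kernelVector H (1 : G) = 0
  · simp [hk]
  obtain ⟨U, hU, hU1, N, hN⟩ := exists_hasOverlapBound_of_isSamplingSet hL2 hinv hk hΛ
  obtain ⟨V, C, hV, hV1, hC, hVC, hNV⟩ := hN.exists_subset_isCompact hU hU1
  refine ENNReal.le_of_forall_pos_le_add fun ε hε _ => ?_
  have hε2 : (0 : ℝ≥0∞) < (ε : ℝ≥0∞) / 2 := ENNReal.half_pos (by simpa using hε.ne')
  obtain ⟨K, hK, hK1, hKF⟩ :=
    exists_isCompact_mul_measure_le_encard hL2 hinv hloc hΛ hNV hV hV1 hC hVC hε2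
  obtain ⟨r, hr, hrS⟩ := exists_tendsto_encard_boundary_le hF hNV hV hV1 hC hVC hK
  rw [← tsub_le_iff_right]
  refine le_liminf_of_le (by isBoundedDefault) ?_
  filter_upwards [hr.eventually (ge_mem_nhds hε2)] with n hn
  refine le_iInf fun x => ?_
  rw [tsub_le_iff_right]
  have h0 : μ (F n) ≠ 0 := (hF.measure_pos n).ne'
  have ht : μ (F n) ≠ ∞ := (hF.isCompact n).measure_lt_top.ne
  -- Here 1 ∈ K is used: a point outside F n lies in (F n)ᶜ K.
  have hsub : F n * K ⊆ F n ∪ ((F n * K) ∩ ((F n)ᶜ * K)) := fun t ht => by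
    by_cases htF : t ∈ F n
    · exact Or.inl htF
    · exact Or.inr ⟨ht, t, htF, 1, hK1, by simp⟩
  calc ‖kernelVector H (1 : G)‖ₑ ^ 2
      = ‖kernelVector H (1 : G)‖ₑ ^ 2 * μ (F n) / μ (F n) := (ENNReal.mul_div_cancel_right h0 ht).symm
    _ ≤ ((Λ ∩ x • F n).encard + (Λ ∩ x • ((F n * K) ∩ ((F n)ᶜ * K))).encard
          + ε / 2 * μ (F n)) / μ (F n) := by
      gcongr
      refine (hKF (F n) (hF.isCompact n) x).trans ?_
      gcongr
      exact encard_le_add_of_subset_union hsub x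
    _ = countRatio μ Λ (F n) x
          + (Λ ∩ x • ((F n * K) ∩ ((F n)ᶜ * K))).encard / μ (F n) + ε / 2 := by
      rw [ENNReal.add_div, ENNReal.add_div, ENNReal.mul_div_cancel_right h0 ht, countRatio]
    _ ≤ countRatio μ Λ (F n) x + ε / 2 + ε / 2 := by
      exact add_le_add_left (add_le_add_right ((hrS n x _ subset_rfl).trans hn) _) _
    _ = countRatio μ Λ (F n) x + ε := by rw [add_assoc, ENNReal.add_halves]

theorem upperBeurlingDensityAlong_le (hF : IsStrongFolner μ F)
    (hL2 : IsIsometricallyEmbedded H μ) (hinv : IsTranslationInvariant (G := G) H)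
    (hΛ : IsInterpolationSet H Λ) :
    upperBeurlingDensityAlong μ F Λ ≤ ‖kernelVector H (1 : G)‖ₑ ^ 2 := by
  obtain ⟨U, hU, hU1, hN⟩ := exists_hasOverlapBound_of_isInterpolationSet hL2 hinv hΛ
  obtain ⟨V, C, hV, hV1, hC, hVC, hNV⟩ := hN.exists_subset_isCompact hU hU1
  refine le_of_forall_mul_one_sub_le (by finiteness) fun ε hε hε1 => ?_
  obtain ⟨K, hK, hK1, hKF⟩ :=
    exists_isCompact_encard_le_mul_measure hL2 hinv hΛ hNV hV hV1 hC hVC hε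
  -- The inverse appears because tk ∉ F n means t = (tk)k⁻¹ ∈ (F n)ᶜ K⁻¹.
  obtain ⟨r, hr, hrS⟩ := exists_tendsto_encard_boundary_le hF hNV hV hV1 hC hVC hK.inv
  have h1ε : (1 - ε) ≠ 0 := (tsub_pos_of_lt hε1).ne'
  rw [← ENNReal.le_div_iff_mul_le (Or.inl h1ε) (Or.inl (by finiteness))]
  refine limsup_le_of_le (by isBoundedDefault) ?_
  filter_upwards [hr.eventually (ge_mem_nhds hε)] with n hn
  refine iSup_le fun x => ?_
  rw [ENNReal.le_div_iff_mul_le (Or.inl h1ε) (Or.inl (by finiteness))]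
  have h0 : μ (F n) ≠ 0 := (hF.measure_pos n).ne'
  have ht : μ (F n) ≠ ∞ := (hF.isCompact n).measure_lt_top.ne
  set F' := {t ∈ F n | ∀ k ∈ K, t * k ∈ F n} with hF'
  have hsub : F n ⊆ F' ∪ ((F n * K⁻¹) ∩ ((F n)ᶜ * K⁻¹)) := fun t ht => by
    by_cases htF : t ∈ F'
    · exact Or.inl htF
    · obtain ⟨k, hk, hkF⟩ : ∃ k ∈ K, t * k ∉ F n := by
        by_contra! hcon
        exact htF ⟨ht, hcon⟩
      exact Or.inr ⟨⟨t, ht, 1, by simpa using hK1, by simp⟩,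
        ⟨t * k, hkF, k⁻¹, by simpa using hk, by simp⟩⟩
  -- The error ε · count moves to the left side, which is legitimate in [0, ∞] because the count is
  -- finite.
  have hE : ((Λ ∩ x • F').encard : ℝ≥0∞) * (1 - ε) ≤ ‖kernelVector H (1 : G)‖ₑ ^ 2 * μ (F n) := by
    have hfin : (Λ ∩ x • F').Finite :=
      (finite_inter_of_hasOverlapBound μ hNV hV hV1 hC hVC ((hF.isCompact n).smul x)).subset
        (inter_subset_inter_right _ (smul_set_mono (sep_subset _ _)))
    have hne : ((Λ ∩ x • F').encard : ℝ≥0∞) ≠ ∞ := by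
      simpa using hfin
    rw [ENNReal.mul_sub fun _ _ => hne, mul_one, tsub_le_iff_right, mul_comm _ ε]
    exact hKF (F n) (hF.isCompact n) x
  calc countRatio μ Λ (F n) x * (1 - ε)
      ≤ ((Λ ∩ x • F').encard + (Λ ∩ x • ((F n * K⁻¹) ∩ ((F n)ᶜ * K⁻¹))).encard) / μ (F n)
          * (1 - ε) := by
        rw [countRatio]
        gcongr
        exact encard_le_add_of_subset_union hsub x
    _ = (Λ ∩ x • F').encard * (1 - ε) / μ (F n)
          + (Λ ∩ x • ((F n * K⁻¹) ∩ ((F n)ᶜ * K⁻¹))).encard / μ (F n) * (1 - ε) := by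
        rw [ENNReal.add_div, add_mul, ENNReal.mul_div_right_comm]
    _ ≤ ‖kernelVector H (1 : G)‖ₑ ^ 2 * μ (F n) / μ (F n) + r n * 1 := by
        gcongr
        · exact hrS n x _ subset_rfl
        · exact tsub_le_self
    _ ≤ ‖kernelVector H (1 : G)‖ₑ ^ 2 + ε := by
        rw [ENNReal.mul_div_cancel_right h0 ht, mul_one]
        gcongr

end Density

end SamplingDensity

end

theorem mainTheorem3
    {G : Type*} [Group G] [TopologicalSpace G] [IsTopologicalGroup G] [T2Space G]
    [LocallyCompactSpace G] [SecondCountableTopology G] [MeasurableSpace G] [BorelSpace G]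
    (μ : Measure G) [μ.IsHaarMeasure] [μ.IsMulRightInvariant]
    (F : ℕ → Set G) (hF : SamplingDensity.IsStrongFolner μ F)
    {H : Type*} [NormedAddCommGroup H] [InnerProductSpace ℂ H] [CompleteSpace H]
    [RKHS ℂ H G ℂ]
    (hL2 : SamplingDensity.IsIsometricallyEmbedded H μ)
    (hinv : SamplingDensity.IsTranslationInvariant (G := G) H)
    (hloc : SamplingDensity.IsLocalized H μ)
    (Λ : Set G) :
    (SamplingDensity.IsSamplingSet H Λ →
      ‖SamplingDensity.kernelVector H (1 : G)‖ₑ ^ 2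
          ≤ SamplingDensity.lowerBeurlingDensityAlong μ F Λ ∧
      ‖SamplingDensity.kernelVector H (1 : G)‖ₑ ^ 2
          ≤ SamplingDensity.lowerBeurlingDensity μ Λ) ∧
    (SamplingDensity.IsInterpolationSet H Λ →
      SamplingDensity.upperBeurlingDensityAlong μ F Λ
          ≤ ‖SamplingDensity.kernelVector H (1 : G)‖ₑ ^ 2 ∧
      SamplingDensity.upperBeurlingDensity μ Λ
          ≤ ‖SamplingDensity.kernelVector H (1 : G)‖ₑ ^ 2) := by
  refine ⟨fun hΛ => ?_, fun hΛ => ?_⟩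
  · have h := SamplingDensity.le_lowerBeurlingDensityAlong hF hL2 hinv hloc hΛ
    exact ⟨h, h.trans (SamplingDensity.lowerBeurlingDensityAlong_le hF Λ)⟩
  · have h := SamplingDensity.upperBeurlingDensityAlong_le hF hL2 hinv hΛ
    exact ⟨h, (SamplingDensity.upperBeurlingDensity_le hF Λ).trans h⟩
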